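/- **Conventions.** Let $G$ be a group. A *$G$-system* of length $n$ is an element of $G^n$. The braid group $B_n$ acts on $G^n$ from the right by $(g_1,\dots,g_n)\cdot\sigma_i=(g_1,\dots,g_{i-1},g_{i+1},g_{i+1}^{-1}g_ig_{i+1},g_{i+2},\dots,g_n)$; two $G$-systems are *Hurwitz equivalent* ($\sim_H$) if they have the same length $n$ and lie in the same $B_n$-orbit, and *HC-equivalent* ($\sim_{HC}$) if they have the same length $n$ and lie in the same orbit of $G\times B_n$, where $x\in G$ acts by $(g_1,\dots,g_n)\mapsto(x^{-1}g_1x,\dots,x^{-1}g_nx)$. The *Coxeter element* of $(g_1,\dots,g_n)$ is $C(g_1,\dots,g_n)=g_1g_2\cdots g_n$. A *finite positive presentation* $\mathcal P=\langle\mathcal S\mid\mathcal R\rangle$ of $G$ is a presentation of $G$ with $\mathcal S$ finite and $\mathcal R$ a finite set of relations $V\equiv W$ between words $V,W$ of the free monoid $\mathcal S^*$; its *associated monoid* $M_{\mathcal P}^+$ is the quotient of $\mathcal S^*$ by the congruence generated by $\mathcal R$. A *generator $G$-system* is a $G$-system all of whose entries are generators from $\mathcal S$. A relation $a_1\cdots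 a_l\equiv a_1'\cdots a_{l'}'$ is *Hurwitz compatible* if $l=l'$ and $(a_1,\dots,a_l)\cdot\beta=(a_1',\dots,a_l')$ in $G^l$ for some $\beta\in B_l$. A *Garside group* is a triple $(G,M,\Delta)$, with $M$ a submonoid of the group $G$ and $\Delta\in M$, such that: $M\cap M^{-1}=\{1\}$; the partial order $a\preceq b\Leftrightarrow a^{-1}b\in M$ on $G$ is a lattice order; $\Delta^{-1}M\Delta=M$; the set $\{s\in G: 1\preceq s\preceq\Delta\}$ is finite and generates $G$; and for each $x\in M$ the number of factors in the expressions of $x$ as a product of elements of $M\setminus\{1\}$ is bounded. An *atom* of $M$ is an element $a\in M$, $a\neq1$, such that $b\in M$ and $b^{-1}a\in M$ imply $b\in\{1,a\}$. **Corollary 3.6.** Let $(G,M,\Delta)$ be a Garside group, and assume that $M$ is the associated monoid of a finite positive presentation $\mathcal P=\langle\mathcal S\mid\mathcal R\rangle$ of $G$ (that is, the interpretation of the generators in $G$ induces an isomorphism $M_{\mathcal P}^+\cong M$) such that 1. all relations in $\mathcal R$ are Hurwitz compatible; 2. the generating set $\mathcal S$ is equal to the set of atoms of $M$. Then for all generator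 $G$-systems $\mathbf a$ and $\mathbf a'$: 1. $\mathbf a\sim_H\mathbf a'$ if and only if $C(\mathbf a)=C(\mathbf a')$. 2. If $\Delta^{-1}C(\mathbf a)\in M$, then $\mathbf a\sim_{HC}\mathbf a'$ if and only if $C(\mathbf a)$ and $C(\mathbf a')$ are conjugate in $G$. -/

import Mathlib

namespace Hurwitz

/-! ### Braid groups -/

/-- The relators of Artin's presentation of the braid group on `n` strings; the generator with
index `i : Fin (n - 1)` exchanges the strings at the positions `i` and `i + 1` (counted from `0`). -/
def braidRelators (n : ℕ) : Set (FreeGroup (Fin (n - 1))) :=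
  {r | ∃ i j : Fin (n - 1), (i : ℕ) + 1 < j ∧
      r = FreeGroup.of i * FreeGroup.of j * (FreeGroup.of j * FreeGroup.of i)⁻¹} ∪
  {r | ∃ i j : Fin (n - 1), (i : ℕ) + 1 = j ∧
      r = FreeGroup.of i * FreeGroup.of j * FreeGroup.of i *
        (FreeGroup.of j * FreeGroup.of i * FreeGroup.of j)⁻¹}

/-- The braid group on `n` strings. -/
abbrev BraidGroup (n : ℕ) : Type := PresentedGroup (braidRelators n)

/-! ### The Hurwitz action on systems of length `n`, that is, on `Fin n → G` -/

section Action

variable {G : Type*} [Group G]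

/-- The action of a single braid generator:
`(…, gᵢ, gᵢ₊₁, …) ↦ (…, gᵢ₊₁, gᵢ₊₁⁻¹ gᵢ gᵢ₊₁, …)`. -/
def hurwitzMove {n : ℕ} (i : Fin (n - 1)) : Equiv.Perm (Fin n → G) where
  toFun g j :=
    if (j : ℕ) = i then g ⟨i + 1, by omega⟩
    else if (j : ℕ) = i + 1 then
      (g ⟨i + 1, by omega⟩)⁻¹ * g ⟨i, by omega⟩ * g ⟨i + 1, by omega⟩
    else g j
  invFun g j :=
    if (j : ℕ) = i then g ⟨i, by omega⟩ * g ⟨i + 1, by omega⟩ * (g ⟨i, by omega⟩)⁻¹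
    else if (j : ℕ) = i + 1 then g ⟨i, by omega⟩
    else g j
  left_inv g := by
    funext j
    rcases j with ⟨j, hj⟩
    by_cases h1 : j = i
    · subst h1; simp [mul_assoc]
    · by_cases h2 : j = i + 1
      · subst h2; simp
      · simp [h1, h2]
  right_inv g := by
    funext j
    rcases j with ⟨j, hj⟩
    by_cases h1 : j = i
    · subst h1; simp
    · by_cases h2 : j = i + 1
      · subst h2; simp [mul_assoc]
      · simp [h1, h2]

theorem hurwitzMove_apply {n : ℕ} (i : Fin (n - 1)) (g : Fin n → G) (j : Fin n) :
    hurwitzMove i g j =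
      if (j : ℕ) = i then g ⟨i + 1, by omega⟩
      else if (j : ℕ) = i + 1 then
        (g ⟨i + 1, by omega⟩)⁻¹ * g ⟨i, by omega⟩ * g ⟨i + 1, by omega⟩
      else g j := rfl

theorem hurwitzMove_comm {n : ℕ} (i j : Fin (n - 1)) (h : (i : ℕ) + 1 < j) (g : Fin n → G) :
    hurwitzMove j (hurwitzMove i g) = hurwitzMove i (hurwitzMove j g) := by
  funext k
  rcases k with ⟨k, hk⟩
  rcases i with ⟨i, hi⟩
  rcases j with ⟨j, hj⟩
  simp only [hurwitzMove_apply] at *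
  have e1 : ¬ j = i := by omega
  have e2 : ¬ j = i + 1 := by omega
  have e3 : ¬ j + 1 = i := by omega
  have e5 : ¬ i = j := by omega
  have e6 : ¬ i = j + 1 := by omega
  have e7 : ¬ i + 1 = j := by omega
  by_cases h1 : k = i
  · subst h1; simp [e5, e6, e7]
  by_cases h2 : k = i + 1
  · subst h2; simp [e5, e6, e7]
  simp [e1, e2, e3, h1, h2]

theorem hurwitzMove_braid {n : ℕ} (i j : Fin (n - 1)) (h : (i : ℕ) + 1 = j) (g : Fin n → G) :
    hurwitzMove i (hurwitzMove j (hurwitzMove i g)) =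
      hurwitzMove j (hurwitzMove i (hurwitzMove j g)) := by
  funext k
  rcases k with ⟨k, hk⟩
  rcases i with ⟨i, hi⟩
  rcases j with ⟨j, hj⟩
  simp only at h
  subst h
  have e1 (l : ℕ) : ¬ l + 1 + 1 = l := by omega
  have e2 (l : ℕ) : ¬ l = l + 1 + 1 := by omega
  simp only [hurwitzMove_apply]
  by_cases h1 : k = i
  · subst h1; simp [e1, e2]
  by_cases h2 : k = i + 1
  · subst h2; simp [e1, e2, mul_assoc]
  by_cases h3 : k = i + 1 + 1
  · subst h3; simp [e1, e2, mul_assoc]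
  simp [h1, h2, h3]

variable (G) in
/-- The Hurwitz action of the braid group on systems of length `n`. It is a right action, hence a
homomorphism into the opposite of the permutation group. -/
def hurwitzHom (n : ℕ) : BraidGroup n →* (Equiv.Perm (Fin n → G))ᵐᵒᵖ :=
  PresentedGroup.toGroup (rels := braidRelators n)
    (f := fun i => MulOpposite.op (hurwitzMove i)) (by
      rintro r (⟨i, j, h, rfl⟩ | ⟨i, j, h, rfl⟩)
      · rw [map_mul, map_inv, mul_inv_eq_one]
        simp only [map_mul, FreeGroup.lift_apply_of]
        apply MulOpposite.unop_injective
        ext1 g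
        exact hurwitzMove_comm i j h g
      · rw [map_mul, map_inv, mul_inv_eq_one]
        simp only [map_mul, FreeGroup.lift_apply_of]
        apply MulOpposite.unop_injective
        ext1 g
        exact hurwitzMove_braid i j h g)

/-- `braidAct g β` is the system `g · β`. -/
def braidAct {n : ℕ} (g : Fin n → G) (β : BraidGroup n) : Fin n → G :=
  (hurwitzHom G n β).unop g

/-- Simultaneous conjugation `(g₁, …, gₙ) · x = (x⁻¹ g₁ x, …, x⁻¹ gₙ x)`. -/
def conjAct {n : ℕ} (g : Fin n → G) (x : G) : Fin n → G := fun i => x⁻¹ * g i * x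

theorem braidAct_of {n : ℕ} (g : Fin n → G) (i : Fin (n - 1)) :
    braidAct g (PresentedGroup.of i) = hurwitzMove i g := by
  simp [braidAct, hurwitzHom]

theorem braidAct_one {n : ℕ} (g : Fin n → G) : braidAct g 1 = g := by
  simp [braidAct]

theorem braidAct_mul {n : ℕ} (g : Fin n → G) (β γ : BraidGroup n) :
    braidAct g (β * γ) = braidAct (braidAct g β) γ := by
  simp [braidAct]

/-- Two systems are Hurwitz equivalent: they have the same length and lie in the same orbit of the
braid group. -/
def HurwitzEquivalent {m n : ℕ} (g : Fin m → G) (g' : Fin n → G) : Prop :=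
  ∃ h : m = n, ∃ β : BraidGroup m, braidAct g β = g' ∘ Fin.cast h

/-- Two systems are Hurwitz-conjugation equivalent: they have the same length and lie in the same
orbit of the product of the group and the braid group. -/
def HCEquivalent {m n : ℕ} (g : Fin m → G) (g' : Fin n → G) : Prop :=
  ∃ h : m = n, ∃ (x : G) (β : BraidGroup m), conjAct (braidAct g β) x = g' ∘ Fin.cast h

/-- The Coxeter element `C(g) = g₁ g₂ ⋯ gₙ` of a system. -/
def coxeterElement {n : ℕ} (g : Fin n → G) : G := (List.ofFn g).prod

/-! ### Positive presentations -/

variable {S : Type*}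

/-- The relators `V⁻¹ W` of the group presentation with positive relations `V ≡ W` in `R`. -/
def groupRelators (R : Set (FreeMonoid S × FreeMonoid S)) : Set (FreeGroup S) :=
  {r | ∃ p ∈ R, r = (FreeMonoid.lift FreeGroup.of p.1)⁻¹ * FreeMonoid.lift FreeGroup.of p.2}

/-- The monoid `S* / ≡` associated with the positive presentation `⟨S | R⟩`. -/
abbrev AssociatedMonoid (R : Set (FreeMonoid S × FreeMonoid S)) : Type _ :=
  PresentedMonoid fun V W => (V, W) ∈ R

/-- `⟨S | R⟩` is a presentation of the group `G`, the generators being interpreted by `ι`. -/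
def PresentsGroup (R : Set (FreeMonoid S × FreeMonoid S)) (ι : S → G) : Prop :=
  ∃ e : PresentedGroup (groupRelators R) ≃* G, ∀ s, e (PresentedGroup.of s) = ι s

/-- The submonoid `M` of `G` is the associated monoid of `⟨S | R⟩`, the generators being
interpreted by `ι`. -/
def IsAssociatedMonoid (R : Set (FreeMonoid S × FreeMonoid S)) (ι : S → G) (M : Submonoid G) :
    Prop :=
  ∃ e : AssociatedMonoid R ≃* M, ∀ s, (e (PresentedMonoid.of _ s) : G) = ι s

/-- The system `(a₁, …, aₗ)` of group elements read off a word `a₁ ⋯ aₗ`. -/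
def wordSystem (ι : S → G) (V : FreeMonoid S) : Fin V.toList.length → G :=
  fun i => ι (V.toList.get i)

/-- A positive relation `V ≡ W` is Hurwitz-compatible: both words have the same length, and a braid
carries the system of `V` to the system of `W`. -/
def HurwitzCompatible (ι : S → G) (V W : FreeMonoid S) : Prop :=
  HurwitzEquivalent (wordSystem ι V) (wordSystem ι W)

/-- A generator system: all entries are positive generators. -/
def IsGeneratorSystem {n : ℕ} (ι : S → G) (g : Fin n → G) : Prop :=
  ∀ i, g i ∈ Set.range ι

/-! ### Garside groups -/

/-- The prefix relation `a ≼ b`, that is, `a⁻¹ b ∈ M`. -/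
def Prefix (M : Submonoid G) (a b : G) : Prop := a⁻¹ * b ∈ M

/-- The atoms of `M`: the elements `a ≠ 1` of `M` whose only prefixes in `M` are `1` and `a`. -/
def atoms (M : Submonoid G) : Set G :=
  {a | a ∈ M ∧ a ≠ 1 ∧ ∀ b ∈ M, Prefix M b a → b = 1 ∨ b = a}

/-- `(G, M, Δ)` is a Garside group (of finite type). -/
structure IsGarside (M : Submonoid G) (Δ : G) : Prop where
  delta_mem : Δ ∈ M
  /-- `M ∩ M⁻¹ = {1}`, so that `≼` is a partial order. -/
  pointed : ∀ x ∈ M, x⁻¹ ∈ M → x = 1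
  /-- Any two elements of `G` have a greatest lower bound for `≼`. -/
  exists_gcd : ∀ a b : G, ∃ d, Prefix M d a ∧ Prefix M d b ∧
    ∀ c, Prefix M c a → Prefix M c b → Prefix M c d
  /-- Any two elements of `G` have a least upper bound for `≼`. -/
  exists_lcm : ∀ a b : G, ∃ d, Prefix M a d ∧ Prefix M b d ∧
    ∀ c, Prefix M a c → Prefix M b c → Prefix M d c
  /-- Conjugation by `Δ` preserves `M`. -/
  conj_mem_iff : ∀ x : G, Δ⁻¹ * x * Δ ∈ M ↔ x ∈ M
  /-- The simple elements, that is, the elements `s` with `1 ≼ s ≼ Δ`, generate `G`. -/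
  closure_simple : Subgroup.closure {s | Prefix M 1 s ∧ Prefix M s Δ} = ⊤
  /-- There are finitely many simple elements. -/
  finite_simple : {s | Prefix M 1 s ∧ Prefix M s Δ}.Finite
  /-- `M` is atomic: for each `x` in `M`, the number of factors in the decompositions of `x` into
  nontrivial elements of `M` is bounded. -/
  atomic : ∀ x ∈ M, ∃ N : ℕ, ∀ l : List G, (∀ y ∈ l, y ∈ M ∧ y ≠ 1) → l.prod = x → l.length ≤ N

end Action

end Hurwitz

/-! A Hurwitz move preserves the product, so Hurwitz equivalent systems have equal Coxeter elements,
and HC-equivalent ones have conjugate Coxeter elements. Conversely, generator systems with equal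
products are words equal in the associated monoid. Hurwitz equivalence of words is a congruence
containing the relations, hence contains the congruence they generate
(`IsAssociatedMonoid.listHurwitz_of_prod_eq`).

For the second equivalence, rotating a system is an HC-equivalence (`ListHC.append_comm`). So it
suffices to join `X = C(a)` to `Y = C(a')` by exchanges `u * v ↔ v * u` inside `M`. Iterated cycling
takes `Y` to some `Z` divisible by `Δ`. Between `X` and `Z` a conjugator can be taken in `M` after
conjugating `Z` by a power of `Δ`; splitting off its gcd with `Δ` keeps the conjugate divisible by
`Δ`, so each step is an exchange. Both inductions terminate because length-preserving relations give
an additive length on `G`, positive on `M \ {1}`. -/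

namespace Hurwitz

/-! ### Hurwitz and HC-equivalence in terms of lists. -/

section Systems

variable {G : Type*} [Group G]

/-- A single Hurwitz move, on lists of group elements. -/
inductive ListMove : List G → List G → Prop
  | mk (p q : List G) (x y : G) : ListMove (p ++ x :: y :: q) (p ++ y :: (y⁻¹ * x * y) :: q)

/-- Hurwitz equivalence of lists of group elements. -/
def ListHurwitz : List G → List G → Prop := Relation.EqvGen ListMove

namespace ListHurwitz

theorem refl (l : List G) : ListHurwitz l l := Relation.EqvGen.refl l

theorem symm {l l' : List G} (h : ListHurwitz l l') : ListHurwitz l' l := Relation.EqvGen.symm _ _ h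

theorem trans {l l' l'' : List G} (h : ListHurwitz l l') (h' : ListHurwitz l' l'') :
    ListHurwitz l l'' := Relation.EqvGen.trans _ _ _ h h'

theorem of_move {l l' : List G} (h : ListMove l l') : ListHurwitz l l' := Relation.EqvGen.rel _ _ h

theorem map_of_move {f : List G → List G} (hf : ∀ l l', ListMove l l' → ListMove (f l) (f l'))
    {l l' : List G} (h : ListHurwitz l l') : ListHurwitz (f l) (f l') := by
  induction h with
  | rel x y h => exact of_move (hf x y h)
  | refl x => exact refl _
  | symm x y _ ih => exact ih.symm
  | trans x y z _ _ ih ih' => exact ih.trans ih'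

theorem append_left (p : List G) {l l' : List G} (h : ListHurwitz l l') :
    ListHurwitz (p ++ l) (p ++ l') := by
  refine map_of_move (f := fun l => p ++ l) ?_ h
  rintro _ _ ⟨a, b, x, y⟩
  simpa using ListMove.mk (p ++ a) b x y

theorem append_right (q : List G) {l l' : List G} (h : ListHurwitz l l') :
    ListHurwitz (l ++ q) (l' ++ q) := by
  refine map_of_move (f := fun l => l ++ q) ?_ h
  rintro _ _ ⟨a, b, x, y⟩
  simpa using ListMove.mk a (b ++ q) x y

theorem append {k k' l l' : List G} (h : ListHurwitz k k') (h' : ListHurwitz l l') :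
    ListHurwitz (k ++ l) (k' ++ l') :=
  (h.append_right l).trans (h'.append_left k')

theorem map (f : G →* G) {l l' : List G} (h : ListHurwitz l l') :
    ListHurwitz (l.map f) (l'.map f) := by
  refine map_of_move ?_ h
  rintro _ _ ⟨a, b, x, y⟩
  simpa using ListMove.mk (a.map f) (b.map f) (f x) (f y)

theorem prod_eq {l l' : List G} (h : ListHurwitz l l') : l.prod = l'.prod := by
  induction h with
  | rel x y h => obtain ⟨a, b, x, y⟩ := h; simp [mul_assoc]
  | refl x => rfl
  | symm x y _ ih => exact ih.symm
  | trans x y z _ _ ih ih' => exact ih.trans ih'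

theorem length_eq {l l' : List G} (h : ListHurwitz l l') : l.length = l'.length := by
  induction h with
  | rel x y h => obtain ⟨a, b, x, y⟩ := h; simp
  | refl x => rfl
  | symm x y _ ih => exact ih.symm
  | trans x y z _ _ ih ih' => exact ih.trans ih'

/-- Moving the last entry of a list to the front conjugates the entries it passes. -/
theorem move_to_front (s : G) (t : List G) :
    ListHurwitz (t ++ [s]) (s :: t.map (fun g => s⁻¹ * g * s)) := by
  induction t with
  | nil => exact refl _
  | cons x t ih =>
    have h1 := ih.append_left [x]
    have h2 := of_move (ListMove.mk [] (t.map fun g => s⁻¹ * g * s) x s)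
    exact h1.trans h2

end ListHurwitz

theorem HurwitzEquivalent.refl {n : ℕ} (g : Fin n → G) : HurwitzEquivalent g g :=
  ⟨rfl, 1, by simp [braidAct_one]⟩

theorem HurwitzEquivalent.symm {m n : ℕ} {g : Fin m → G} {g' : Fin n → G}
    (h : HurwitzEquivalent g g') : HurwitzEquivalent g' g := by
  obtain ⟨rfl, β, h⟩ := h
  have h' : braidAct g β = g' := h
  exact ⟨rfl, β⁻¹, by rw [← h', ← braidAct_mul]; simp [braidAct_one]⟩

theorem HurwitzEquivalent.trans {l m n : ℕ} {g : Fin l → G} {g' : Fin m → G} {g'' : Fin n → G}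
    (h : HurwitzEquivalent g g') (h' : HurwitzEquivalent g' g'') : HurwitzEquivalent g g'' := by
  obtain ⟨rfl, β, h⟩ := h
  obtain ⟨rfl, γ, h'⟩ := h'
  exact ⟨rfl, β * γ, by
    rw [braidAct_mul, h]
    exact h'⟩

theorem listMove_ofFn {n : ℕ} (i : Fin (n - 1)) (g : Fin n → G) :
    ListMove (List.ofFn g) (List.ofFn (hurwitzMove i g)) := by
  obtain ⟨i, hi⟩ := i
  have e1 : List.ofFn g = (List.ofFn g).take i ++ g ⟨i, by omega⟩ :: g ⟨i + 1, by omega⟩ ::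
      (List.ofFn g).drop (i + 2) := by
    have h0 : i < (List.ofFn g).length := by simp; omega
    have h1 : i + 1 < (List.ofFn g).length := by simp; omega
    conv_lhs => rw [← List.take_append_drop i (List.ofFn g), List.drop_eq_getElem_cons h0,
      List.drop_eq_getElem_cons h1]
    simp
  have e2 : List.ofFn (hurwitzMove ⟨i, hi⟩ g) = (List.ofFn g).take i ++ g ⟨i + 1, by omega⟩ ::
      ((g ⟨i + 1, by omega⟩)⁻¹ * g ⟨i, by omega⟩ * g ⟨i + 1, by omega⟩) ::
      (List.ofFn g).drop (i + 2) := by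
    apply List.ext_getElem
    · simp; omega
    · intro k hk hk'
      have hin : i < n := by omega
      rw [List.getElem_ofFn, hurwitzMove_apply]
      simp only [List.length_ofFn] at hk
      rcases lt_trichotomy k i with h | h | h
      · rw [List.getElem_append_left (by simp; omega)]
        simp [show k ≠ i by omega, show k ≠ i + 1 by omega]
      · subst h
        rw [List.getElem_append_right (by simp)]
        simp [hin.le]
      · rw [List.getElem_append_right (by simp; omega)]
        obtain ⟨d, rfl⟩ : ∃ d, k = i + (d + 1) := ⟨k - i - 1, by omega⟩
        simp only [List.length_take, List.length_ofFn, min_eq_left hin.le, Nat.add_sub_cancel_left]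
        rcases d with _ | d
        · simp
        · simp [show i + (d + 1 + 1) = i + 2 + d by omega,
            show i + 2 + d ≠ i by omega, show i + 2 + d ≠ i + 1 by omega]
  rw [e2, e1]
  convert ListMove.mk _ _ _ _ using 3
  · rw [← e1]
  · rw [← e1]

theorem listHurwitz_braidAct {n : ℕ} (g : Fin n → G) (β : BraidGroup n) :
    ListHurwitz (List.ofFn g) (List.ofFn (braidAct g β)) := by
  have hβ : β ∈ Subgroup.closure (Set.range (PresentedGroup.of (rels := braidRelators n))) := by
    rw [PresentedGroup.closure_range_of]; trivial
  induction hβ using Subgroup.closure_induction generalizing g with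
  | mem x hx =>
    obtain ⟨i, rfl⟩ := hx
    rw [braidAct_of]
    exact .of_move (listMove_ofFn i g)
  | one => rw [braidAct_one]; exact .refl _
  | mul x y _ _ hx hy => rw [braidAct_mul]; exact (hx g).trans (hy _)
  | inv x _ hx =>
    have := hx (braidAct g x⁻¹)
    rw [← braidAct_mul, inv_mul_cancel, braidAct_one] at this
    exact this.symm

theorem HurwitzEquivalent.of_ofFn_eq {m n : ℕ} {g : Fin m → G} {g' : Fin n → G}
    (h : List.ofFn g = List.ofFn g') : HurwitzEquivalent g g' := by
  have hmn : m = n := by simpa using congrArg List.length h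
  subst hmn
  rw [List.ofFn_injective h]
  exact .refl _

theorem ListMove.hurwitzEquivalent {l l' : List G} (h : ListMove l l') :
    HurwitzEquivalent l.get l'.get := by
  obtain ⟨p, q, x, y⟩ := h
  have hi : p.length < (p ++ x :: y :: q).length - 1 := by simp
  refine ⟨by simp, PresentedGroup.of ⟨p.length, hi⟩, ?_⟩
  rw [braidAct_of]
  funext k
  obtain ⟨k, hk⟩ := k
  rw [hurwitzMove_apply]
  simp only [List.get_eq_getElem, Function.comp_apply, Fin.val_cast]
  rcases lt_trichotomy k p.length with h | h | h
  · rw [List.getElem_append_left h, List.getElem_append_left h]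
    simp [show k ≠ p.length by omega, show k ≠ p.length + 1 by omega]
  · subst h
    simp
  · obtain ⟨d, rfl⟩ : ∃ d, k = p.length + (d + 1) := ⟨k - p.length - 1, by omega⟩
    rcases d with _ | d
    · simp
    · rw [if_neg (by omega), if_neg (by omega), List.getElem_append_right (by omega),
        List.getElem_append_right (by omega)]
      simp only [Nat.add_sub_cancel_left, List.getElem_cons_succ]

/-- The braid generators act by single moves and generate the braid group, so orbits are the classes
generated by moves. Lists make concatenation available without casts between index types. -/
theorem hurwitzEquivalent_iff {m n : ℕ} {g : Fin m → G} {g' : Fin n → G} :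
    HurwitzEquivalent g g' ↔ ListHurwitz (List.ofFn g) (List.ofFn g') := by
  constructor
  · rintro ⟨rfl, β, h⟩
    have h' : braidAct g β = g' := h
    rw [← h']
    exact listHurwitz_braidAct g β
  · intro h
    have key : ∀ l l' : List G, ListHurwitz l l' → HurwitzEquivalent l.get l'.get := by
      intro l l' h
      induction h with
      | rel x y h => exact h.hurwitzEquivalent
      | refl x => exact .refl _
      | symm x y _ ih => exact ih.symm
      | trans x y z _ _ ih ih' => exact ih.trans ih'
    exact ((HurwitzEquivalent.of_ofFn_eq (by rw [List.ofFn_get])).trans (key _ _ h)).trans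
      (HurwitzEquivalent.of_ofFn_eq (by rw [List.ofFn_get]))

/-- Hurwitz-conjugation equivalence of lists of group elements. -/
def ListHC (l l' : List G) : Prop :=
  ∃ x : G, ListHurwitz (l.map fun g => x⁻¹ * g * x) l'

theorem ListHurwitz.map_conj (x : G) {l l' : List G} (h : ListHurwitz l l') :
    ListHurwitz (l.map fun g => x⁻¹ * g * x) (l'.map fun g => x⁻¹ * g * x) := by
  convert h.map (MulAut.conj x⁻¹).toMonoidHom using 2 <;> (funext g; simp [MulAut.conj_symm_apply])

namespace ListHC

theorem of_listHurwitz {l l' : List G} (h : ListHurwitz l l') : ListHC l l' :=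
  ⟨1, by simpa using h⟩

theorem symm {l l' : List G} : ListHC l l' → ListHC l' l := by
  rintro ⟨x, h⟩
  refine ⟨x⁻¹, ?_⟩
  simpa [mul_assoc, Function.comp_def] using (h.map_conj x⁻¹).symm

theorem trans {l l' l'' : List G} : ListHC l l' → ListHC l' l'' → ListHC l l'' := by
  rintro ⟨x, h⟩ ⟨y, h'⟩
  refine ⟨x * y, ?_⟩
  have := (h.map_conj y).trans h'
  simpa [mul_assoc, Function.comp_def] using this

/-- Conjugating by the first entry `s` and then undoing `move_to_front` carries `s` to the end;
doing this for each entry of `l` rotates the list. -/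
theorem append_comm (l k : List G) : ListHC (l ++ k) (k ++ l) := by
  induction l generalizing k with
  | nil => simpa using of_listHurwitz (ListHurwitz.refl k)
  | cons s t ih =>
    have h : ListHC (s :: (t ++ k)) ((t ++ k) ++ [s]) :=
      ⟨s, by simpa using (ListHurwitz.move_to_front s (t ++ k)).symm⟩
    simpa using h.trans (by simpa using ih (k ++ [s]))

end ListHC

/-- Conjugation commutes with Hurwitz moves, so it does not matter that one side conjugates after
the braid and the other before it. -/
theorem hcEquivalent_iff {m n : ℕ} {g : Fin m → G} {g' : Fin n → G} :
    HCEquivalent g g' ↔ ListHC (List.ofFn g) (List.ofFn g') := by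
  have hmap : ∀ {k : ℕ} (f : Fin k → G) (x : G),
      (List.ofFn f).map (fun g => x⁻¹ * g * x) = List.ofFn (conjAct f x) := by
    intro k f x
    rw [List.map_ofFn]
    rfl
  constructor
  · rintro ⟨rfl, x, β, h⟩
    have h' : conjAct (braidAct g β) x = g' := h
    refine ⟨x, ?_⟩
    rw [← h', ← hmap]
    exact (listHurwitz_braidAct g β).map_conj x
  · rintro ⟨x, h⟩
    have h1 := h.map_conj x⁻¹
    have h2 : ListHurwitz (List.ofFn g) (List.ofFn (conjAct g' x⁻¹)) := by
      rw [← hmap]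
      simpa only [List.map_map, Function.comp_def, inv_inv, mul_assoc, mul_inv_cancel_left,
        mul_inv_cancel, mul_one, List.map_id'] using h1
    obtain ⟨rfl, β, hβ⟩ := hurwitzEquivalent_iff.2 h2
    refine ⟨rfl, x, β, ?_⟩
    rw [hβ]
    funext i
    simp [conjAct, mul_assoc]

end Systems
end Hurwitz

namespace Hurwitz

/-! ### Conjugacy and cyclic exchanges in Garside groups. -/

section Garside

variable {G : Type*} [Group G]

/-- Two elements are cyclically equivalent with respect to `M` if they are related by a chain of
exchanges `u * v ↔ v * u` with `u, v ∈ M`. -/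
def CyclicEquiv (M : Submonoid G) : G → G → Prop :=
  Relation.EqvGen fun X Y => ∃ u ∈ M, ∃ v ∈ M, X = u * v ∧ Y = v * u

namespace CyclicEquiv

variable {M : Submonoid G} {X Y Z : G}

theorem refl (X : G) : CyclicEquiv M X X := Relation.EqvGen.refl X

theorem symm (h : CyclicEquiv M X Y) : CyclicEquiv M Y X := Relation.EqvGen.symm _ _ h

theorem trans (h : CyclicEquiv M X Y) (h' : CyclicEquiv M Y Z) : CyclicEquiv M X Z :=
  Relation.EqvGen.trans _ _ _ h h'

theorem conj_prefix {s : G} (hs : s ∈ M) (h : s⁻¹ * X ∈ M) : CyclicEquiv M X (s⁻¹ * X * s) :=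
  Relation.EqvGen.rel _ _ ⟨s, hs, s⁻¹ * X, h, by group, by group⟩

theorem mem_iff (h : CyclicEquiv M X Y) : X ∈ M ↔ Y ∈ M := by
  induction h with
  | rel X Y h =>
    obtain ⟨u, hu, v, hv, rfl, rfl⟩ := h
    exact ⟨fun _ => mul_mem hv hu, fun _ => mul_mem hu hv⟩
  | refl X => rfl
  | symm X Y _ ih => exact ih.symm
  | trans X Y Z _ _ ih ih' => exact ih.trans ih'

theorem isConj (h : CyclicEquiv M X Y) : IsConj X Y := by
  induction h with
  | rel X Y h =>
    obtain ⟨u, hu, v, hv, rfl, rfl⟩ := h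
    exact isConj_iff.2 ⟨u⁻¹, by group⟩
  | refl X => exact .refl _
  | symm X Y _ ih => exact ih.symm
  | trans X Y Z _ _ ih ih' => exact ih.trans ih'

end CyclicEquiv

namespace IsGarside

variable {M : Submonoid G} {Δ : G} (hG : IsGarside M Δ)
include hG

theorem conj_mem {x : G} (hx : x ∈ M) : Δ⁻¹ * x * Δ ∈ M := (hG.conj_mem_iff x).2 hx

theorem conj_pow_mem_iff (k : ℕ) (x : G) : (Δ ^ k)⁻¹ * x * Δ ^ k ∈ M ↔ x ∈ M := by
  induction k generalizing x with
  | zero => simp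
  | succ k ih =>
    rw [← ih x, ← hG.conj_mem_iff ((Δ ^ k)⁻¹ * x * Δ ^ k)]
    simp [pow_succ, mul_assoc]

/-- Simple elements divide `Δ` and their inverses divide `1`; products are handled by moving powers
of `Δ` across elements of `M`. -/
theorem exists_inv_mul_pow_mem (g : G) : ∃ k : ℕ, g⁻¹ * Δ ^ k ∈ M := by
  have hg : g ∈ Subgroup.closure {s | Prefix M 1 s ∧ Prefix M s Δ} := by
    rw [hG.closure_simple]; trivial
  rw [← Subgroup.mem_toSubmonoid, Subgroup.closure_toSubmonoid] at hg
  induction hg using Submonoid.closure_induction with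
  | mem x hx =>
    rcases hx with hx | hx
    · exact ⟨1, by simpa [Prefix] using hx.2⟩
    · exact ⟨0, by simpa [Prefix] using hx.1⟩
  | one => exact ⟨0, by simp⟩
  | mul x y _ _ hx hy =>
    obtain ⟨k, hk⟩ := hx
    obtain ⟨l, hl⟩ := hy
    refine ⟨k + l, ?_⟩
    have := mul_mem hl ((hG.conj_pow_mem_iff l _).2 hk)
    rw [add_comm, pow_add]
    convert this using 1
    have hc : Δ ^ l * Δ ^ k = Δ ^ k * Δ ^ l := by rw [← pow_add, add_comm, pow_add]
    rw [hc]
    group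

theorem exists_mul_pow_mem (g : G) : ∃ k : ℕ, g * Δ ^ k ∈ M := by
  simpa using hG.exists_inv_mul_pow_mem g⁻¹

theorem exists_pow_mul_mem (g : G) : ∃ k : ℕ, Δ ^ k * g ∈ M := by
  obtain ⟨k, hk⟩ := hG.exists_mul_pow_mem g
  refine ⟨k, ?_⟩
  rw [← hG.conj_pow_mem_iff k]
  simpa using hk

/-- Some `Δ ^ k` is a multiple of `y`, and the exponent can be lowered step by step to `0`; then `y`
and `y⁻¹` both lie in `M`. -/
theorem eq_one_of_gcd_delta {y : G} (hy : y ∈ M)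
    (h : ∀ c, Prefix M c y → Prefix M c Δ → Prefix M c 1) : y = 1 := by
  have hpow : ∀ k : ℕ, Prefix M y (Δ ^ k) → Prefix M y 1 := by
    intro k
    induction k with
    | zero => simp
    | succ k ih =>
      intro hk
      apply ih
      -- This common prefix of `y` and `Δ` is a prefix of `1` exactly when `y` is a prefix of `Δ ^
      -- k`.
      have := h (y * (Δ ^ k)⁻¹) ?_ ?_
      · rw [Prefix, ← hG.conj_pow_mem_iff k] at this
        simpa [Prefix] using this
      · simp [Prefix, pow_mem hG.delta_mem]
      · rw [Prefix, ← hG.conj_pow_mem_iff k]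
        simpa [Prefix, pow_succ', mul_assoc] using hk
  obtain ⟨k, hk⟩ := hG.exists_inv_mul_pow_mem y
  exact hG.pointed y hy (by simpa [Prefix] using hpow k hk)

/-- If `X` and its conjugate `Y = x⁻¹ * X * x`, with `x ∈ M`, are both divisible by `Δ`, then so
is the conjugate of `X` by the greatest common prefix of `x` and `Δ`. -/
theorem delta_prefix_conj_gcd {X Y x s : G} (hX : Δ⁻¹ * X ∈ M) (hY : Δ⁻¹ * Y ∈ M)
    (h : X * x = x * Y) (hsx : Prefix M s x) (hsΔ : Prefix M s Δ)
    (hs : ∀ c, Prefix M c x → Prefix M c Δ → Prefix M c s) : Δ⁻¹ * (s⁻¹ * X * s) ∈ M := by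
  -- The goal says that `X⁻¹ * s * Δ` is a prefix of `s`, so the universal property of the gcd
  -- reduces it to being a prefix of `x` and of `Δ`.
  have hc := hs (X⁻¹ * s * Δ) ?_ ?_
  · simpa [Prefix, mul_assoc] using hc
  · have := mul_mem (hG.conj_mem hsx) hY
    simp only [Prefix, mul_inv_rev, inv_inv, mul_assoc] at this ⊢
    rw [h]
    simpa using this
  · have := mul_mem (hG.conj_mem hsΔ) (hG.conj_mem hX)
    simpa [Prefix, mul_assoc] using this

/-- Induction on the length of `x`: the gcd `s` of `x` and `Δ` is nontrivial and is a prefix of `X`,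
so conjugation by `s` is an exchange and leaves the shorter conjugator `s⁻¹ * x`. -/
theorem cyclicEquiv_of_delta_prefix_of_mem (L : G → ℤ) (hL : ∀ x y, L (x * y) = L x + L y)
    (hpos : ∀ x ∈ M, x ≠ 1 → 0 < L x) {X Y x : G} (hx : x ∈ M) (hX : Δ⁻¹ * X ∈ M)
    (hY : Δ⁻¹ * Y ∈ M) (h : X * x = x * Y) : CyclicEquiv M X Y := by
  induction hn : (L x).toNat using Nat.strong_induction_on generalizing X x with
  | _ n ih =>
    by_cases hx1 : x = 1
    · subst hx1
      simp only [mul_one, one_mul] at h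
      exact h ▸ .refl _
    obtain ⟨s, hsx, hsΔ, hs⟩ := hG.exists_gcd x Δ
    have hsM : s ∈ M := by
      simpa [Prefix] using hs 1 (by simpa [Prefix] using hx) (by simpa [Prefix] using hG.delta_mem)
    have hs1 : s ≠ 1 := fun e => hx1 (hG.eq_one_of_gcd_delta hx fun c h1 h2 => e ▸ hs c h1 h2)
    have hsX : s⁻¹ * X ∈ M := by simpa [Prefix, mul_assoc] using mul_mem hsΔ hX
    have hXs := hG.delta_prefix_conj_gcd hX hY h hsx hsΔ hs
    have hLx : L x = L s + L (s⁻¹ * x) := by rw [← hL]; simp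
    have hlt := hpos s hsM hs1
    have hLx0 := hpos x hx hx1
    exact (CyclicEquiv.conj_prefix hsM hsX).trans
      (ih _ (by omega) hsx hXs (by simp [mul_assoc, h]) rfl)

theorem cyclicEquiv_conj_delta_pow {Y : G} (hY : Δ⁻¹ * Y ∈ M) (k : ℕ) :
    CyclicEquiv M Y ((Δ ^ k)⁻¹ * Y * Δ ^ k) := by
  induction k with
  | zero => simpa using CyclicEquiv.refl (M := M) Y
  | succ k ih =>
    have h1 : Δ⁻¹ * ((Δ ^ k)⁻¹ * Y * Δ ^ k) ∈ M := by
      have := (hG.conj_pow_mem_iff k _).2 hY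
      have hc : Δ⁻¹ * (Δ ^ k)⁻¹ = (Δ ^ k)⁻¹ * Δ⁻¹ := by
        rw [← mul_inv_rev, ← mul_inv_rev, ← pow_succ, ← pow_succ']
      rw [← mul_assoc, ← mul_assoc, hc]
      simpa [mul_assoc] using this
    have := ih.trans (CyclicEquiv.conj_prefix hG.delta_mem h1)
    simpa [pow_succ, mul_assoc] using this

/-- Multiplying an arbitrary conjugator by a power of `Δ` puts it in `M`; conjugating `Y` by that
power is itself a chain of exchanges. -/
theorem cyclicEquiv_of_delta_prefix (L : G → ℤ) (hL : ∀ x y, L (x * y) = L x + L y)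
    (hpos : ∀ x ∈ M, x ≠ 1 → 0 < L x) {X Y : G} (hX : Δ⁻¹ * X ∈ M)
    (hY : Δ⁻¹ * Y ∈ M) (h : IsConj X Y) : CyclicEquiv M X Y := by
  obtain ⟨c, hc⟩ := isConj_iff.1 h
  obtain ⟨k, hk⟩ := hG.exists_mul_pow_mem c⁻¹
  have h1 := hG.cyclicEquiv_conj_delta_pow hY k
  refine CyclicEquiv.trans ?_ h1.symm
  have hYk : Δ⁻¹ * ((Δ ^ k)⁻¹ * Y * Δ ^ k) ∈ M := by
    have := (hG.conj_pow_mem_iff k _).2 hY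
    have hc : Δ⁻¹ * (Δ ^ k)⁻¹ = (Δ ^ k)⁻¹ * Δ⁻¹ := by
      rw [← mul_inv_rev, ← mul_inv_rev, ← pow_succ, ← pow_succ']
    rw [← mul_assoc, ← mul_assoc, hc]
    simpa [mul_assoc] using this
  refine hG.cyclicEquiv_of_delta_prefix_of_mem L hL hpos hk hX hYk ?_
  rw [← hc]
  group

/-- Iterated cycling: a conjugate in `M` of an element divisible by `Δ` is cyclically equivalent
to an element divisible by `Δ`. -/
theorem exists_cyclicEquiv_delta_prefix_of_mem (L : G → ℤ) (hL : ∀ x y, L (x * y) = L x + L y)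
    (hpos : ∀ x ∈ M, x ≠ 1 → 0 < L x) {Y y : G} (hY : Y ∈ M) (hy : y ∈ M)
    (h : Δ⁻¹ * (y * Y * y⁻¹) ∈ M) : ∃ Z, Δ⁻¹ * Z ∈ M ∧ CyclicEquiv M Y Z := by
  induction hn : (L y).toNat using Nat.strong_induction_on generalizing Y y with
  | _ n ih =>
    obtain ⟨s, hsY, hsΔ, hs⟩ := hG.exists_gcd Y Δ
    by_cases hsd : s = Δ
    · subst hsd
      exact ⟨Y, hsY, .refl _⟩
    have hsM : s ∈ M := by
      simpa [Prefix] using hs 1 (by simpa [Prefix] using hY) (by simpa [Prefix] using hG.delta_mem)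
    -- This is the conjugator for the next round, from `s⁻¹ * Y * s` to a `Δ`-conjugate of the
    -- original target. It is shorter than `y` by the length of `s⁻¹ * Δ`, positive because `s ≠ Δ`.
    have hy1 : Δ⁻¹ * y * s ∈ M := by
      have hc := hs (y⁻¹ * Δ) ?_ ?_
      · simpa [Prefix, mul_assoc] using hc
      · simpa [Prefix, mul_assoc] using mul_mem h hy
      · simpa [Prefix, mul_assoc] using hG.conj_mem hy
    have hlt : 0 < L (s⁻¹ * Δ) := hpos _ hsΔ fun e => hsd (inv_mul_eq_one.1 e)
    have hLΔ : L Δ = L s + L (s⁻¹ * Δ) := by rw [← hL]; simp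
    have hLy : L y + L s = L Δ + L (Δ⁻¹ * y * s) := by
      rw [← hL, ← hL]; congr 1; group
    have hL1 : L 1 = 0 := by simpa using hL 1 1
    have hnn : ∀ x ∈ M, 0 ≤ L x := fun x hx => by
      by_cases e : x = 1
      · rw [e, hL1]
      · exact (hpos x hx e).le
    have h0 := hnn _ hy1
    have hconj : Δ⁻¹ * ((Δ⁻¹ * y * s) * (s⁻¹ * Y * s) * (Δ⁻¹ * y * s)⁻¹) ∈ M := by
      have := hG.conj_mem h
      convert this using 1
      group
    obtain ⟨Z, hZ, hYZ⟩ := ih _ (by omega) (mul_mem hsY hsM) hy1 hconj rfl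
    exact ⟨Z, hZ, (CyclicEquiv.conj_prefix hsM hsY).trans hYZ⟩

theorem exists_cyclicEquiv_delta_prefix (L : G → ℤ) (hL : ∀ x y, L (x * y) = L x + L y)
    (hpos : ∀ x ∈ M, x ≠ 1 → 0 < L x) {X Y : G} (hX : Δ⁻¹ * X ∈ M) (hY : Y ∈ M)
    (h : IsConj X Y) : ∃ Z, Δ⁻¹ * Z ∈ M ∧ CyclicEquiv M Y Z := by
  obtain ⟨c, hc⟩ := isConj_iff.1 h
  obtain ⟨k, hk⟩ := hG.exists_pow_mul_mem c⁻¹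
  refine hG.exists_cyclicEquiv_delta_prefix_of_mem L hL hpos hY hk ?_
  rw [← hG.conj_pow_mem_iff k]
  have e : (Δ ^ k)⁻¹ * (Δ⁻¹ * (Δ ^ k * c⁻¹ * Y * (Δ ^ k * c⁻¹)⁻¹)) * Δ ^ k = Δ⁻¹ * X := by
    rw [← hc]
    group
  rwa [e]

theorem cyclicEquiv_of_isConj (L : G → ℤ) (hL : ∀ x y, L (x * y) = L x + L y)
    (hpos : ∀ x ∈ M, x ≠ 1 → 0 < L x) {X Y : G} (hX : Δ⁻¹ * X ∈ M) (hY : Y ∈ M)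
    (h : IsConj X Y) : CyclicEquiv M X Y := by
  obtain ⟨Z, hZ, hYZ⟩ := hG.exists_cyclicEquiv_delta_prefix L hL hpos hX hY h
  exact (hG.cyclicEquiv_of_delta_prefix L hL hpos hX hZ (h.trans hYZ.isConj)).trans hYZ.symm

end IsGarside
end Garside
end Hurwitz

namespace Hurwitz

/-! ### From equations and exchanges in the monoid to equivalences of systems. -/

section Presentation

variable {G : Type*} {S : Type*} {ι : S → G}

theorem ofFn_wordSystem (ι : S → G) (V : FreeMonoid S) :
    List.ofFn (wordSystem ι V) = V.toList.map ι := by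
  conv_rhs => rw [← List.ofFn_get V.toList, List.map_ofFn]
  rfl

theorem exists_map_eq {l : List G} (h : ∀ g ∈ l, g ∈ Set.range ι) :
    ∃ V : FreeMonoid S, V.toList.map ι = l := by
  induction l with
  | nil => exact ⟨1, rfl⟩
  | cons g l ih =>
    obtain ⟨s, rfl⟩ := h g (by simp)
    obtain ⟨V, hV⟩ := ih fun g hg => h g (by simp [hg])
    exact ⟨FreeMonoid.of s * V, by simp [hV]⟩

variable [Group G] {R : Set (FreeMonoid S × FreeMonoid S)} {M : Submonoid G}

theorem HurwitzCompatible.listHurwitz {V W : FreeMonoid S} (h : HurwitzCompatible ι V W) :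
    ListHurwitz (V.toList.map ι) (W.toList.map ι) := by
  rw [← ofFn_wordSystem, ← ofFn_wordSystem]
  exact hurwitzEquivalent_iff.1 h

variable (ι) in
/-- Hurwitz equivalence of the systems read off words, as a congruence on the free monoid. -/
def hurwitzCon : Con (FreeMonoid S) where
  r V W := ListHurwitz (V.toList.map ι) (W.toList.map ι)
  iseqv := ⟨fun _ => .refl _, fun h => h.symm, fun h h' => h.trans h'⟩
  mul' h h' := by simpa using h.append h'

theorem IsAssociatedMonoid.exists_mulEquiv (h : IsAssociatedMonoid R ι M) :
    ∃ e : AssociatedMonoid R ≃* M, ∀ V,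
      (e (PresentedMonoid.mk _ V) : G) = (V.toList.map ι).prod := by
  obtain ⟨e, he⟩ := h
  refine ⟨e, fun V => ?_⟩
  induction V using FreeMonoid.inductionOn' with
  | one => simp
  | of_mul s V ih =>
    rw [map_mul, map_mul, Submonoid.coe_mul, ih]
    have := he s
    simp only [PresentedMonoid.of] at this
    simp [this]

theorem IsAssociatedMonoid.listHurwitz_of_prod_eq (hmon : IsAssociatedMonoid R ι M)
    (hcompat : ∀ V W : FreeMonoid S, (V, W) ∈ R → HurwitzCompatible ι V W) {l l' : List G}
    (hl : ∀ g ∈ l, g ∈ Set.range ι) (hl' : ∀ g ∈ l', g ∈ Set.range ι)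
    (h : l.prod = l'.prod) : ListHurwitz l l' := by
  obtain ⟨e, he⟩ := hmon.exists_mulEquiv
  obtain ⟨V, rfl⟩ := exists_map_eq hl
  obtain ⟨W, rfl⟩ := exists_map_eq hl'
  rw [← he, ← he] at h
  have h1 := PresentedMonoid.mk_eq_mk_iff.1 (e.injective (Subtype.ext h))
  have h2 : conGen (fun V W => (V, W) ∈ R) ≤ hurwitzCon ι :=
    Con.conGen_le.2 fun V W hVW => (hcompat V W hVW).listHurwitz
  exact h2 h1

theorem IsAssociatedMonoid.exists_list (hmon : IsAssociatedMonoid R ι M) {x : G} (hx : x ∈ M) :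
    ∃ l : List G, (∀ g ∈ l, g ∈ Set.range ι) ∧ l.prod = x := by
  obtain ⟨e, he⟩ := hmon.exists_mulEquiv
  obtain ⟨V, hV⟩ := PresentedMonoid.surjective_mk (e.symm ⟨x, hx⟩)
  refine ⟨V.toList.map ι, by simp, ?_⟩
  rw [← he, hV]
  simp

theorem IsAssociatedMonoid.prod_mem (hmon : IsAssociatedMonoid R ι M) {l : List G}
    (hl : ∀ g ∈ l, g ∈ Set.range ι) : l.prod ∈ M := by
  obtain ⟨e, he⟩ := hmon.exists_mulEquiv
  obtain ⟨V, rfl⟩ := exists_map_eq hl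
  rw [← he]
  exact SetLike.coe_mem _

/-- A presentation with length-preserving relations has a length function. -/
theorem PresentsGroup.exists_length (hpres : PresentsGroup R ι)
    (hlen : ∀ V W : FreeMonoid S, (V, W) ∈ R → V.toList.length = W.toList.length) :
    ∃ L : G → ℤ, (∀ x y, L (x * y) = L x + L y) ∧ ∀ s, L (ι s) = 1 := by
  obtain ⟨e, he⟩ := hpres
  have hword : ∀ V : FreeMonoid S, FreeGroup.lift (fun _ : S => Multiplicative.ofAdd (1 : ℤ))
      (FreeMonoid.lift FreeGroup.of V) = Multiplicative.ofAdd (V.toList.length : ℤ) := by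
    intro V
    induction V using FreeMonoid.inductionOn' with
    | one => simp
    | of_mul s V ih =>
      rw [map_mul, map_mul, ih]
      simp [add_comm]
  have hrel : ∀ r ∈ groupRelators R,
      FreeGroup.lift (fun _ : S => Multiplicative.ofAdd (1 : ℤ)) r = 1 := by
    rintro _ ⟨⟨V, W⟩, hp, rfl⟩
    rw [map_mul, map_inv, hword, hword, hlen V W hp, inv_mul_cancel]
  refine ⟨fun g => (PresentedGroup.toGroup hrel (e.symm g)).toAdd, fun x y => by simp,
    fun s => ?_⟩
  simp [← he]

theorem IsAssociatedMonoid.length_pos (hmon : IsAssociatedMonoid R ι M) {L : G → ℤ}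
    (hL : ∀ x y, L (x * y) = L x + L y) (hι : ∀ s, L (ι s) = 1) {x : G} (hx : x ∈ M)
    (hx1 : x ≠ 1) : 0 < L x := by
  obtain ⟨l, hl, rfl⟩ := hmon.exists_list hx
  have hL1 : L 1 = 0 := by simpa using hL 1 1
  have hnn : ∀ l : List G, (∀ g ∈ l, g ∈ Set.range ι) → 0 ≤ L l.prod := by
    intro l hl
    induction l with
    | nil => simp [hL1]
    | cons g l ih =>
      obtain ⟨s, rfl⟩ := hl g (by simp)
      have := ih fun g hg => hl g (by simp [hg])
      rw [List.prod_cons, hL, hι]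
      omega
  cases l with
  | nil => simp at hx1
  | cons g l =>
    obtain ⟨s, rfl⟩ := hl g (by simp)
    have := hnn l fun g hg => hl g (by simp [hg])
    rw [List.prod_cons, hL, hι]
    omega

/-- Each exchange lifts to a rotation of words for `u` and `v`; the choice of words is immaterial
because equal products give Hurwitz equivalence. Membership in `M` propagates along the chain, so
every intermediate element has a word. -/
theorem IsAssociatedMonoid.listHC_of_cyclicEquiv (hmon : IsAssociatedMonoid R ι M)
    (hcompat : ∀ V W : FreeMonoid S, (V, W) ∈ R → HurwitzCompatible ι V W) {X Y : G}
    (hX : X ∈ M) (h : CyclicEquiv M X Y) {l l' : List G}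
    (hl : ∀ g ∈ l, g ∈ Set.range ι) (hl' : ∀ g ∈ l', g ∈ Set.range ι)
    (hlX : l.prod = X) (hlY : l'.prod = Y) : ListHC l l' := by
  induction h generalizing l l' with
  | rel X Y h =>
    obtain ⟨u, hu, v, hv, rfl, rfl⟩ := h
    obtain ⟨k, hk, rfl⟩ := hmon.exists_list hu
    obtain ⟨k', hk', rfl⟩ := hmon.exists_list hv
    have hm : ∀ {p q : List G}, (∀ g ∈ p, g ∈ Set.range ι) → (∀ g ∈ q, g ∈ Set.range ι) →
        ∀ g ∈ p ++ q, g ∈ Set.range ι := fun hp hq g hg =>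
      (List.mem_append.1 hg).elim (hp g) (hq g)
    have h1 := hmon.listHurwitz_of_prod_eq hcompat hl (hm hk hk') (by simp [hlX])
    have h2 := hmon.listHurwitz_of_prod_eq hcompat (hm hk' hk) hl' (by simp [hlY])
    exact ((ListHC.of_listHurwitz h1).trans (ListHC.append_comm k k')).trans
      (ListHC.of_listHurwitz h2)
  | refl X => exact .of_listHurwitz (hmon.listHurwitz_of_prod_eq hcompat hl hl' (hlX.trans hlY.symm))
  | symm X Y h ih => exact (ih ((CyclicEquiv.mem_iff h).2 hX) hl' hl hlY hlX).symm
  | trans X Y Z h _ ih ih' =>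
    have hY := (CyclicEquiv.mem_iff h).1 hX
    obtain ⟨k, hk, hkY⟩ := hmon.exists_list hY
    exact (ih hX hl hk hlX hkY).trans (ih' hY hk hl' hkY hlY)

end Presentation

theorem ListHC.isConj_prod {G : Type*} [Group G] {l l' : List G} (h : ListHC l l') :
    IsConj l.prod l'.prod := by
  obtain ⟨x, h⟩ := h
  refine isConj_iff.2 ⟨x⁻¹, ?_⟩
  rw [← h.prod_eq]
  have := map_list_prod (MulAut.conj x⁻¹) l
  have e : (l.map fun g => x⁻¹ * g * x) = l.map (MulAut.conj x⁻¹) := by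
    congr 1; funext g; simp [MulAut.conj_symm_apply]
  rw [e, ← this, MulAut.conj_apply]

end Hurwitz

theorem corollary3p6 {G : Type*} [Group G] (M : Submonoid G) (Δ : G)
    (hG : Hurwitz.IsGarside M Δ)
    {S : Type*} [Finite S] (R : Set (FreeMonoid S × FreeMonoid S)) (hRfin : R.Finite)
    (ι : S → G)
    (hpres : Hurwitz.PresentsGroup R ι)
    (hmon : Hurwitz.IsAssociatedMonoid R ι M)
    (hcompat : ∀ V W : FreeMonoid S, (V, W) ∈ R → Hurwitz.HurwitzCompatible ι V W)
    (hatoms : Set.range ι = Hurwitz.atoms M)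
    {m n : ℕ} (a : Fin m → G) (a' : Fin n → G)
    (ha : Hurwitz.IsGeneratorSystem ι a) (ha' : Hurwitz.IsGeneratorSystem ι a') :
    (Hurwitz.HurwitzEquivalent a a' ↔
      Hurwitz.coxeterElement a = Hurwitz.coxeterElement a') ∧
    (Δ⁻¹ * Hurwitz.coxeterElement a ∈ M →
      (Hurwitz.HCEquivalent a a' ↔
        IsConj (Hurwitz.coxeterElement a) (Hurwitz.coxeterElement a'))) := by
  have hl : ∀ g ∈ List.ofFn a, g ∈ Set.range ι := by
    simpa [List.mem_ofFn, Hurwitz.IsGeneratorSystem] using ha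
  have hl' : ∀ g ∈ List.ofFn a', g ∈ Set.range ι := by
    simpa [List.mem_ofFn, Hurwitz.IsGeneratorSystem] using ha'
  refine ⟨?_, fun hΔ => ?_⟩
  · rw [Hurwitz.hurwitzEquivalent_iff]
    exact ⟨fun h => h.prod_eq, fun h => hmon.listHurwitz_of_prod_eq hcompat hl hl' h⟩
  · rw [Hurwitz.hcEquivalent_iff]
    refine ⟨fun h => h.isConj_prod, fun h => ?_⟩
    -- Hurwitz compatibility includes equality of the word lengths, which is what the length
    -- function needs.
    obtain ⟨L, hL, hι⟩ := hpres.exists_length fun V W hVW => (hcompat V W hVW).1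
    exact hmon.listHC_of_cyclicEquiv hcompat (hmon.prod_mem hl)
      (hG.cyclicEquiv_of_isConj L hL (fun x hx => hmon.length_pos hL hι hx) hΔ
        (hmon.prod_mem hl') h) hl hl' rfl rfl
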